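/- For real $z$ let $\lambda=\lambda(z)$ be the square root of $z$ on $[0,\infty)\cup i[0,\infty)$, i.e. $\lambda(z)=\sqrt{z}$ for $z\ge 0$ and $\lambda(z)=i\sqrt{-z}$ for $z<0$; a function of $\lambda$ is said to belong to $L^p_z(\mathbb{R})$ if it belongs to $L^p(\mathbb{R})$ as a function of $z$. For a complex-valued function $r$ of $\lambda\in\mathbb{R}\cup i\mathbb{R}$ and $x\in\mathbb{R}$ put $$ S(x;\lambda)=\begin{bmatrix}|r(\lambda)|^2&\overline{r(\lambda)}e^{-2i\lambda^2x}\\ r(\lambda)e^{2i\lambda^2x}&0\end{bmatrix}\ (\lambda\in\mathbb{R}),\qquad S(x;\lambda)=\begin{bmatrix}-|r(\lambda)|^2&-\overline{r(\lambda)}e^{-2i\lambda^2x}\\ r(\lambda)e^{2i\lambda^2x}&0\end{bmatrix}\ (\lambda\in i\mathbb{R}\setminus\{0\}), $$ let $$ \mathcal{P}^-(h)(z)=\lim_{\epsilon\downarrow0}\frac1{2\pi i}\int_{\mathbb{R}}\frac{h(s)}{s-(z-i\epsilon)}\,ds\quad\text{for a.e. }z\in\mathbb{R}, $$ acting componentwise,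 and let $\mathcal{P}^-_S G:=\mathcal{P}^-(GS)$ for row vectors $G\in L^2_z(\mathbb{R};\mathbb{C}^2)$, where $(GS)(z)=G(z)S(x;\lambda(z))$. **Lemma.** For all $M\ge0$ and $c_0>0$ there is a constant $C>0$, depending only on $M$ and $c_0$, such that the following holds for every $r\in L^2_z(\mathbb{R})\cap L^\infty_z(\mathbb{R})$ with $\|r\|_{L^\infty_z}\le M$ and $$ 1-|r(\lambda(z))|^2\ge c_0^2\quad\text{for a.e. }z<0 , $$ and for every $x\in\mathbb{R}$. The operator $\mathcal{P}^-_S$ is well defined (the limits exist almost everywhere) and bounded on $L^2_z(\mathbb{R};\mathbb{C}^2)$, the operator $I-\mathcal{P}^-_S$ is bijective on $L^2_z(\mathbb{R};\mathbb{C}^2)$, its inverse is bounded, and for every row vector $f\in L^2_z(\mathbb{R};\mathbb{C}^2)$ $$ \|(I-\mathcal{P}^-_S)^{-1}f\|_{L^2_z}\le C\|f\|_{L^2_z}. $$ -/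

import Mathlib

open Filter Topology MeasureTheory
open scoped ENNReal NNReal Matrix

noncomputable section

/-- The square root `k` of `z = k ^ 2` on `[0, ∞) ∪ i [0, ∞)`, by which the real `z`-line is
parameterized: `√z` for `z ≥ 0` and `i √(-z)` for `z < 0`. -/
def spectralRoot (z : ℝ) : ℂ :=
  if 0 ≤ z then ((Real.sqrt z : ℝ) : ℂ) else Complex.I * ((Real.sqrt (-z) : ℝ) : ℂ)

/-- The scattering matrix `S(x; k)` of a reflection coefficient `r`, for `k` on `ℝ ∪ i ℝ`:
the first form is for real `k`, the second one for imaginary `k`. -/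
def scatteringMatrix (r : ℂ → ℂ) (x : ℝ) (k : ℂ) : Matrix (Fin 2) (Fin 2) ℂ :=
  if k.im = 0 then
    !![((‖r k‖ ^ 2 : ℝ) : ℂ), star (r k) * Complex.exp (-2 * Complex.I * k ^ 2 * x);
       r k * Complex.exp (2 * Complex.I * k ^ 2 * x), 0]
  else
    !![-((‖r k‖ ^ 2 : ℝ) : ℂ), -star (r k) * Complex.exp (-2 * Complex.I * k ^ 2 * x);
       r k * Complex.exp (2 * Complex.I * k ^ 2 * x), 0]

/-- The Cauchy operator `C(h)(w) = (2 π i)⁻¹ ∫ h(s) / (s - w) ds`, for `w` off the real line. -/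
def cauchyOperator (h : ℝ → ℂ) (w : ℂ) : ℂ :=
  (2 * (Real.pi : ℂ) * Complex.I)⁻¹ * ∫ s : ℝ, h s / ((s : ℂ) - w)

/-- `P⁻(h) = p`: for almost every real `z` the limit of `C(h)(z - ε i)` as `ε ↓ 0` exists and
equals `p z`. -/
def HasPlemeljMinus (h p : ℝ → ℂ) : Prop :=
  ∀ᵐ z : ℝ, Tendsto (fun ε : ℝ => cauchyOperator h ((z : ℂ) - (ε : ℂ) * Complex.I))
    (𝓝[>] 0) (𝓝 (p z))

/-- The space `L²_z(ℝ)` of row vectors with two complex components, with the norm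
`(∫ (|f₁|² + |f₂|²) dz)^{1/2}`. -/
abbrev RowL2 : Type := Lp (EuclideanSpace ℂ (Fin 2)) 2 (volume : Measure ℝ)

/-- `Q` is the operator `P⁻_S G = P⁻(G S)` on `L²_z(ℝ)`; here `G S` is the product of the row
vector `G(z)` and the matrix `S(x; k)` with `k ^ 2 = z`, and `P⁻` acts on each component. -/
def IsPlemeljScattering (r : ℂ → ℂ) (x : ℝ) (Q : RowL2 →L[ℂ] RowL2) : Prop :=
  ∀ (G : RowL2) (j : Fin 2),
    HasPlemeljMinus
      (fun z : ℝ => (WithLp.ofLp (G z) ᵥ* scatteringMatrix r x (spectralRoot z)) j)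
      (fun z : ℝ => (Q G) z j)

end

/-! Let `Π` be the orthogonal projection of L² onto the Hardy space of the lower half-plane. Then P⁻
= -Π, so with T the right multiplication by S and V = 1 + T, the operator I - P⁻_S is 1 + ΠT = (1 -
Π) + ΠV. No smallness of r is needed: V is coercive, Re⟨Vg, g⟩ ≥ c‖g‖², with c depending only on M
and c₀. For z ≥ 0 the matrix I + S is Hermitian with determinant 1 and bounded trace; for z < 0 the
off-diagonal entries of S cancel in the real part, which leaves diag(1 - |r|², 1).

Coercivity passes to the compression A = (1 - Π) + ΠVΠ, and (1 - Π) + ΠV equals A up to a unipotent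
factor, so it is invertible with a bound in terms of c and ‖V‖ (`exists_equiv_of_coercive_symbol`).

The identity P⁻ = -Π holds because a Cauchy integral below the line is minus a Poisson integral of
the projection (`cauchyOperator_eq_neg_integral_poissonKernelLine`), and Poisson integrals converge
almost everywhere (`ae_tendsto_integral_poissonKernelLine`). -/

noncomputable section

/-! ### Poisson integrals and their boundary values -/

/-- The Poisson kernel of the half-plane. -/
def poissonKernelLine (ε t : ℝ) : ℝ := (Real.pi * ε)⁻¹ * (1 + (t / ε) ^ 2)⁻¹

lemma poissonKernelLine_nonneg {ε : ℝ} (hε : 0 < ε) (t : ℝ) : 0 ≤ poissonKernelLine ε t := by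
  unfold poissonKernelLine
  positivity

lemma integrable_poissonKernelLine {ε : ℝ} (hε : 0 < ε) (z : ℝ) :
    Integrable (fun s => poissonKernelLine ε (s - z)) :=
  ((integrable_inv_one_add_sq.comp_div hε.ne').const_mul _).comp_sub_right z

lemma integral_poissonKernelLine {ε : ℝ} (hε : 0 < ε) (z : ℝ) :
    ∫ s, poissonKernelLine ε (s - z) = 1 := by
  rw [integral_sub_right_eq_self (poissonKernelLine ε) z]
  unfold poissonKernelLine
  rw [integral_const_mul, Measure.integral_comp_div (fun t : ℝ => (1 + t ^ 2)⁻¹),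
    integral_univ_inv_one_add_sq, abs_of_pos hε, smul_eq_mul]
  have := Real.pi_pos
  field_simp

lemma continuous_poissonKernelLine (ε : ℝ) : Continuous (poissonKernelLine ε) := by
  unfold poissonKernelLine
  refine continuous_const.mul (Continuous.inv₀ (by fun_prop) fun t => by positivity)

lemma memLp_poissonKernelLine {ε : ℝ} (hε : 0 < ε) (z : ℝ) :
    MemLp (fun s => poissonKernelLine ε (s - z)) 2 := by
  have hc : Continuous (fun s => poissonKernelLine ε (s - z)) :=
    (continuous_poissonKernelLine ε).comp (by fun_prop)
  rw [memLp_two_iff_integrable_sq hc.aestronglyMeasurable]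
  refine ((integrable_poissonKernelLine hε z).const_mul (Real.pi * ε)⁻¹).mono'
    (hc.pow 2).aestronglyMeasurable (ae_of_all _ fun s => ?_)
  have h0 := poissonKernelLine_nonneg hε (s - z)
  rw [Real.norm_of_nonneg (by positivity), sq]
  refine mul_le_mul_of_nonneg_right ?_ h0
  have := Real.pi_pos
  exact mul_le_of_le_one_right (by positivity) (inv_le_one_of_one_le₀ (by nlinarith [sq_nonneg ((s - z) / ε)]))

lemma lintegral_Ioi_poissonWeight {a : ℝ} (ha : 0 ≤ a) :
    ∫⁻ v in Set.Ioi a, ENNReal.ofReal (2 * v / (1 + v ^ 2) ^ 2) =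
      ENNReal.ofReal (1 + a ^ 2)⁻¹ := by
  have hd : ∀ v ∈ Set.Ici a, HasDerivAt (fun v : ℝ => -(1 + v ^ 2)⁻¹) (2 * v / (1 + v ^ 2) ^ 2) v := by
    intro v _
    have h1 : HasDerivAt (fun v : ℝ => 1 + v ^ 2) (2 * v) v := by
      simpa using (hasDerivAt_pow 2 v).const_add 1
    have h2 := (h1.inv (by positivity)).neg
    exact h2.congr_deriv (by rw [neg_div, neg_neg])
  have hp : ∀ v ∈ Set.Ioi a, 0 ≤ 2 * v / (1 + v ^ 2) ^ 2 := fun v hv => by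
    have : 0 ≤ v := ha.trans (Set.mem_Ioi.1 hv).le
    positivity
  have hl : Tendsto (fun v : ℝ => -(1 + v ^ 2)⁻¹) atTop (𝓝 0) := by
    rw [← neg_zero]
    exact (tendsto_inv_atTop_zero.comp
      (tendsto_atTop_add_const_left _ 1 (tendsto_pow_atTop two_ne_zero))).neg
  rw [← ofReal_integral_eq_lintegral_ofReal (integrableOn_Ioi_deriv_of_nonneg' hd hp hl)
    ((ae_restrict_iff' measurableSet_Ioi).2 (ae_of_all _ hp)),
    integral_Ioi_of_hasDerivAt_of_nonneg' hd hp hl]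
  simp

/-- The Poisson kernel is a superposition of indicators of centred intervals. -/
lemma ofReal_poissonKernelLine {ε : ℝ} (hε : 0 < ε) (t : ℝ) :
    ENNReal.ofReal (poissonKernelLine ε t) =
      ∫⁻ v in Set.Ioi 0, ENNReal.ofReal ((Real.pi * ε)⁻¹ * (2 * v / (1 + v ^ 2) ^ 2)) *
        {p : ℝ × ℝ | |p.1| ≤ ε * p.2}.indicator 1 (t, v) := by
  have hpi := Real.pi_pos
  have h0 : 0 ≤ |t| / ε := by positivity
  have : poissonKernelLine ε t = (Real.pi * ε)⁻¹ * (1 + (|t| / ε) ^ 2)⁻¹ := by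
    rw [poissonKernelLine, div_pow, div_pow, sq_abs]
  rw [this, ENNReal.ofReal_mul (by positivity), ← lintegral_Ioi_poissonWeight h0,
    ← lintegral_const_mul' _ _ ENNReal.ofReal_ne_top,
    -- Endpoints are null; closed half-lines match the closed condition |t| ≤ εv.
    setLIntegral_congr (Ioi_ae_eq_Ici (a := |t| / ε)),
    setLIntegral_congr (Ioi_ae_eq_Ici (a := (0 : ℝ))), ← lintegral_indicator measurableSet_Ici,
    ← lintegral_indicator measurableSet_Ici]
  refine lintegral_congr fun v => ?_
  by_cases hv : |t| / ε ≤ v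
  · have h1 : |t| ≤ ε * v := by rwa [div_le_iff₀' hε] at hv
    rw [Set.indicator_of_mem (Set.mem_Ici.2 hv), Set.indicator_of_mem (Set.mem_Ici.2 (h0.trans hv)),
      Set.indicator_of_mem (by exact h1), ENNReal.ofReal_mul (by positivity)]
    simp
  · have h1 : ¬ |t| ≤ ε * v := by rwa [div_le_iff₀' hε] at hv
    rw [Set.indicator_of_notMem (by simpa using hv)]
    by_cases hv0 : v ∈ Set.Ici (0 : ℝ)
    · rw [Set.indicator_of_mem hv0, Set.indicator_of_notMem (by exact h1), mul_zero]
    · rw [Set.indicator_of_notMem hv0]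

/-- Tonelli applied to the superposition of intervals. Once the interval length 2εv is moved into
the weight, the weight no longer depends on ε, which prepares dominated convergence as ε ↓ 0. -/
lemma lintegral_poissonKernelLine_mul {ε : ℝ} (hε : 0 < ε) (z : ℝ) {φ : ℝ → ℝ≥0∞}
    (hφ : AEMeasurable φ) :
    ∫⁻ s, ENNReal.ofReal (poissonKernelLine ε (s - z)) * φ s =
      ∫⁻ v in Set.Ioi 0, ENNReal.ofReal (Real.pi⁻¹ * (4 * v ^ 2 / (1 + v ^ 2) ^ 2)) *
        ((∫⁻ s in Metric.closedBall z (ε * v), φ s) / volume (Metric.closedBall z (ε * v))) := by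
  have hpi := Real.pi_pos
  have hm : MeasurableSet {p : ℝ × ℝ | |p.1| ≤ ε * p.2} :=
    measurableSet_le (by fun_prop) (by fun_prop)
  calc
    _ = ∫⁻ s, ∫⁻ v in Set.Ioi 0, ENNReal.ofReal ((Real.pi * ε)⁻¹ * (2 * v / (1 + v ^ 2) ^ 2)) *
        {p : ℝ × ℝ | |p.1| ≤ ε * p.2}.indicator 1 (s - z, v) * φ s := by
      refine lintegral_congr fun s => ?_
      rw [ofReal_poissonKernelLine hε, lintegral_mul_const]
      refine Measurable.mul (by fun_prop) ?_
      exact (measurable_one.indicator hm).comp (by fun_prop : Measurable fun v : ℝ => (s - z, v))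
    _ = ∫⁻ v in Set.Ioi 0, ∫⁻ s, ENNReal.ofReal ((Real.pi * ε)⁻¹ * (2 * v / (1 + v ^ 2) ^ 2)) *
        {p : ℝ × ℝ | |p.1| ≤ ε * p.2}.indicator 1 (s - z, v) * φ s := by
      refine lintegral_lintegral_swap ?_
      refine AEMeasurable.mul (AEMeasurable.mul (Measurable.aemeasurable ?_)
        (Measurable.aemeasurable ?_)) ?_
      · fun_prop
      · exact (measurable_one.indicator hm).comp
          (by fun_prop : Measurable fun p : ℝ × ℝ => (p.1 - z, p.2))
      · exact hφ.comp_fst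
    _ = _ := by
      refine setLIntegral_congr_fun measurableSet_Ioi fun v hv => ?_
      have hv : 0 < v := hv
      have h1 : ∀ s, ENNReal.ofReal ((Real.pi * ε)⁻¹ * (2 * v / (1 + v ^ 2) ^ 2)) *
          {p : ℝ × ℝ | |p.1| ≤ ε * p.2}.indicator 1 (s - z, v) * φ s =
          ENNReal.ofReal ((Real.pi * ε)⁻¹ * (2 * v / (1 + v ^ 2) ^ 2)) *
          (Metric.closedBall z (ε * v)).indicator φ s := by
        intro s
        by_cases hs : |s - z| ≤ ε * v
        · rw [Set.indicator_of_mem (by exact hs), Set.indicator_of_mem (by exact hs)]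
          simp
        · rw [Set.indicator_of_notMem (by exact hs), Set.indicator_of_notMem (by exact hs)]
          simp
      simp_rw [h1]
      rw [lintegral_const_mul' _ _ ENNReal.ofReal_ne_top,
        lintegral_indicator measurableSet_closedBall, Real.volume_closedBall]
      have h2 : Real.pi⁻¹ * (4 * v ^ 2 / (1 + v ^ 2) ^ 2) =
          ((Real.pi * ε)⁻¹ * (2 * v / (1 + v ^ 2) ^ 2)) * (2 * (ε * v)) := by
        field_simp
        norm_num
      rw [h2, ENNReal.ofReal_mul (p := (Real.pi * ε)⁻¹ * (2 * v / (1 + v ^ 2) ^ 2)) (by positivity),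
        mul_assoc, ENNReal.mul_div_cancel (by simp; positivity) ENNReal.ofReal_ne_top]

lemma lintegral_poissonProfile_ne_top :
    ∫⁻ v in Set.Ioi (0 : ℝ), ENNReal.ofReal (Real.pi⁻¹ * (4 * v ^ 2 / (1 + v ^ 2) ^ 2)) ≠ ∞ := by
  have hpi := Real.pi_pos
  have hc : Continuous fun v : ℝ => Real.pi⁻¹ * (4 * v ^ 2 / (1 + v ^ 2) ^ 2) :=
    continuous_const.mul (Continuous.div (by fun_prop) (by fun_prop) fun v => by positivity)
  have : Integrable fun v : ℝ => Real.pi⁻¹ * (4 * v ^ 2 / (1 + v ^ 2) ^ 2) := by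
    refine (integrable_inv_one_add_sq.const_mul (Real.pi⁻¹ * 4)).mono' hc.aestronglyMeasurable
      (ae_of_all _ fun v => ?_)
    rw [Real.norm_of_nonneg (by positivity), mul_assoc]
    refine mul_le_mul_of_nonneg_left ?_ (by positivity)
    rw [← div_eq_mul_inv, div_le_div_iff₀ (by positivity) (by positivity)]
    nlinarith [sq_nonneg v, sq_nonneg (1 + v ^ 2)]
  exact this.integrableOn.lintegral_lt_top.ne

/-- Supplies the dominating constant for radii at least δ, via |u| ≤ 1 + |u|²; smaller radii are
controlled by the Lebesgue point condition. -/
lemma lintegral_closedBall_enorm_sub_div_le {u : ℝ → ℂ} (z : ℝ) {δ R : ℝ} (hδ : 0 < δ)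
    (hR : δ ≤ R) :
    (∫⁻ s in Metric.closedBall z R, ‖u s - u z‖ₑ) / volume (Metric.closedBall z R) ≤
      1 + ‖u z‖ₑ + (∫⁻ s, ‖u s‖ₑ ^ 2) / ENNReal.ofReal (2 * δ) := by
  have hv0 : volume (Metric.closedBall z R) ≠ 0 := by
    rw [Real.volume_closedBall]
    simp
    linarith
  have hvt : volume (Metric.closedBall z R) ≠ ∞ := by
    rw [Real.volume_closedBall]
    exact ENNReal.ofReal_ne_top
  have hle : ∫⁻ s in Metric.closedBall z R, ‖u s - u z‖ₑ ≤
      (1 + ‖u z‖ₑ) * volume (Metric.closedBall z R) + ∫⁻ s, ‖u s‖ₑ ^ 2 := by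
    calc
      _ ≤ ∫⁻ s in Metric.closedBall z R, ((1 + ‖u z‖ₑ) + ‖u s‖ₑ ^ 2) := by
        refine lintegral_mono fun s => ?_
        have h1 : ‖u s‖ₑ ≤ 1 + ‖u s‖ₑ ^ 2 := by
          rcases le_total ‖u s‖ₑ 1 with h | h
          · exact h.trans le_self_add
          · exact (le_self_pow h two_ne_zero).trans le_add_self
        calc
          ‖u s - u z‖ₑ ≤ ‖u s‖ₑ + ‖u z‖ₑ := enorm_sub_le
          _ ≤ (1 + ‖u s‖ₑ ^ 2) + ‖u z‖ₑ := by gcongr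
          _ = _ := by ring
      _ = (1 + ‖u z‖ₑ) * volume (Metric.closedBall z R) +
          ∫⁻ s in Metric.closedBall z R, ‖u s‖ₑ ^ 2 := by
        rw [lintegral_add_left measurable_const, setLIntegral_const]
      _ ≤ _ := by
        gcongr
        exact Measure.restrict_le_self
  calc
    _ ≤ ((1 + ‖u z‖ₑ) * volume (Metric.closedBall z R) + ∫⁻ s, ‖u s‖ₑ ^ 2) /
        volume (Metric.closedBall z R) := by gcongr
    _ = 1 + ‖u z‖ₑ + (∫⁻ s, ‖u s‖ₑ ^ 2) / volume (Metric.closedBall z R) := by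
      rw [ENNReal.add_div, ENNReal.mul_div_cancel_right hv0 hvt]
    _ ≤ _ := by
      rw [Real.volume_closedBall]
      gcongr

/-- The Poisson integrals of a function in `L²(ℝ)` converge to it at its Lebesgue points. -/
lemma tendsto_lintegral_poissonKernelLine {u : ℝ → ℂ} (hu : MemLp u 2) {z : ℝ}
    (hz : Tendsto (fun R => (∫⁻ s in Metric.closedBall z R, ‖u s - u z‖ₑ) /
      volume (Metric.closedBall z R)) (𝓝[>] 0) (𝓝 0)) :
    Tendsto (fun ε => ∫⁻ s, ENNReal.ofReal (poissonKernelLine ε (s - z)) * ‖u s - u z‖ₑ)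
      (𝓝[>] 0) (𝓝 0) := by
  set A : ℝ → ℝ≥0∞ := fun R => (∫⁻ s in Metric.closedBall z R, ‖u s - u z‖ₑ) /
      volume (Metric.closedBall z R) with hA
  obtain ⟨K, hK, hAK⟩ : ∃ K : ℝ≥0∞, K ≠ ∞ ∧ ∀ R, 0 < R → A R ≤ K := by
    obtain ⟨δ, hδ, hδA⟩ := mem_nhdsGT_iff_exists_Ioo_subset.1 (hz (Iio_mem_nhds one_pos))
    have hδ : 0 < δ := hδ
    refine ⟨1 + (1 + ‖u z‖ₑ + (∫⁻ s, ‖u s‖ₑ ^ 2) / ENNReal.ofReal (2 * δ)), ?_, fun R hR => ?_⟩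
    · have : ∫⁻ s, ‖u s‖ₑ ^ 2 < ∞ := by
        have := lintegral_rpow_enorm_lt_top_of_eLpNorm_lt_top two_ne_zero ENNReal.ofNat_ne_top hu.2
        simpa using this
      have h2 : (∫⁻ s, ‖u s‖ₑ ^ 2) / ENNReal.ofReal (2 * δ) ≠ ∞ :=
        ENNReal.div_ne_top this.ne (by simpa using hδ)
      finiteness
    · by_cases h : R < δ
      · exact (le_of_lt (hδA ⟨hR, h⟩)).trans le_self_add
      · exact (lintegral_closedBall_enorm_sub_div_le z hδ (not_lt.1 h)).trans le_add_self
  have hmeas : AEMeasurable (fun s => ‖u s - u z‖ₑ) :=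
    (hu.1.sub aestronglyMeasurable_const).enorm
  have hAm : Measurable A := by
    refine Measurable.div ?_ ?_
    · refine Monotone.measurable fun a b hab => ?_
      exact lintegral_mono_set (Metric.closedBall_subset_closedBall hab)
    · refine Monotone.measurable fun a b hab => ?_
      exact measure_mono (Metric.closedBall_subset_closedBall hab)
  have hkey : Tendsto (fun ε : ℝ => ∫⁻ v in Set.Ioi (0 : ℝ),
      ENNReal.ofReal (Real.pi⁻¹ * (4 * v ^ 2 / (1 + v ^ 2) ^ 2)) * A (ε * v)) (𝓝[>] 0)
      (𝓝 (∫⁻ _ in Set.Ioi (0 : ℝ), 0)) := by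
    refine tendsto_lintegral_filter_of_dominated_convergence
      (fun v => ENNReal.ofReal (Real.pi⁻¹ * (4 * v ^ 2 / (1 + v ^ 2) ^ 2)) * K) ?_ ?_ ?_ ?_
    · exact Eventually.of_forall fun ε => Measurable.mul (by fun_prop) (hAm.comp (by fun_prop))
    · filter_upwards [self_mem_nhdsWithin] with ε hε
      refine (ae_restrict_iff' measurableSet_Ioi).2 (ae_of_all _ fun v hv => ?_)
      gcongr
      exact hAK _ (mul_pos hε (Set.mem_Ioi.1 hv))
    · rw [lintegral_mul_const' _ _ hK]
      exact ENNReal.mul_ne_top lintegral_poissonProfile_ne_top hK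
    · refine (ae_restrict_iff' measurableSet_Ioi).2 (ae_of_all _ fun v hv => ?_)
      have h1 : Tendsto (fun ε : ℝ => ε * v) (𝓝[>] 0) (𝓝[>] 0) := by
        refine tendsto_nhdsWithin_iff.2 ⟨?_, ?_⟩
        · have : Tendsto (fun ε : ℝ => ε * v) (𝓝 0) (𝓝 (0 * v)) := tendsto_id.mul_const v
          rw [zero_mul] at this
          exact this.mono_left nhdsWithin_le_nhds
        · filter_upwards [self_mem_nhdsWithin] with ε hε
          exact mul_pos (Set.mem_Ioi.1 hε) (Set.mem_Ioi.1 hv)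
      have := ENNReal.Tendsto.const_mul (a := ENNReal.ofReal (Real.pi⁻¹ * (4 * v ^ 2 / (1 + v ^ 2) ^ 2)))
        (hz.comp h1) (Or.inr ENNReal.ofReal_ne_top)
      simpa using this
  rw [lintegral_zero] at hkey
  refine hkey.congr' ?_
  filter_upwards [self_mem_nhdsWithin] with ε hε
  rw [lintegral_poissonKernelLine_mul hε z hmeas]

lemma ae_tendsto_integral_poissonKernelLine {u : ℝ → ℂ} (hu : MemLp u 2) :
    ∀ᵐ z : ℝ, Tendsto (fun ε => ∫ s, (poissonKernelLine ε (s - z) : ℂ) * u s)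
      (𝓝[>] 0) (𝓝 (u z)) := by
  have hloc : LocallyIntegrable u := hu.locallyIntegrable (by norm_num)
  filter_upwards [(Besicovitch.vitaliFamily (volume : Measure ℝ)).ae_tendsto_lintegral_enorm_sub_div
    hloc] with z hz
  have hz := tendsto_lintegral_poissonKernelLine hu
    (hz.comp (Besicovitch.tendsto_filterAt volume z))
  rw [tendsto_iff_edist_tendsto_0]
  refine tendsto_of_tendsto_of_tendsto_of_le_of_le' tendsto_const_nhds hz
    (Eventually.of_forall fun _ => zero_le) ?_
  filter_upwards [self_mem_nhdsWithin] with ε hε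
  have hε : 0 < ε := hε
  have hint : Integrable fun s => (poissonKernelLine ε (s - z) : ℂ) :=
    (integrable_poissonKernelLine hε z).ofReal
  have hone : ∫ s, (poissonKernelLine ε (s - z) : ℂ) = 1 := by
    rw [integral_complex_ofReal, integral_poissonKernelLine hε, Complex.ofReal_one]
  have hint2 : Integrable fun s => (poissonKernelLine ε (s - z) : ℂ) * u s :=
    MemLp.integrable_mul (p := 2) (q := 2) (memLp_poissonKernelLine hε z).ofReal hu
  have : (∫ s, (poissonKernelLine ε (s - z) : ℂ) * u s) - u z =
      ∫ s, (poissonKernelLine ε (s - z) : ℂ) * (u s - u z) := by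
    simp_rw [mul_sub]
    rw [integral_sub hint2 (hint.mul_const _), integral_mul_const, hone, one_mul]
  rw [edist_eq_enorm_sub, this]
  refine (enorm_integral_le_lintegral_enorm _).trans (lintegral_mono fun s => ?_)
  rw [enorm_mul, ← ofReal_norm, Complex.norm_real,
    Real.norm_of_nonneg (poissonKernelLine_nonneg hε _)]

/-! ### Cauchy kernels and the Hardy projection -/

lemma ofReal_sub_ne_zero {a : ℂ} (ha : a.im ≠ 0) (s : ℝ) : (s : ℂ) - a ≠ 0 := fun h => by
  have := congrArg Complex.im h
  simp [ha] at this

lemma memLp_inv_ofReal_sub {a : ℂ} (ha : a.im ≠ 0) : MemLp (fun s : ℝ => ((s : ℂ) - a)⁻¹) 2 := by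
  have hc : Continuous fun s : ℝ => ((s : ℂ) - a)⁻¹ :=
    Continuous.inv₀ (by fun_prop) (ofReal_sub_ne_zero ha)
  rw [memLp_two_iff_integrable_sq_norm hc.aestronglyMeasurable]
  have hi : Integrable fun s : ℝ => (a.im ^ 2)⁻¹ * (1 + ((s - a.re) / a.im) ^ 2)⁻¹ :=
    ((integrable_inv_one_add_sq.comp_div ha).const_mul _).comp_sub_right a.re
  refine hi.congr (ae_of_all _ fun s => ?_)
  have h1 : ‖(s : ℂ) - a‖ ^ 2 = (s - a.re) ^ 2 + a.im ^ 2 := by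
    rw [← Complex.normSq_eq_norm_sq, Complex.normSq_apply]
    simp
    ring
  simp only [norm_inv, inv_pow, h1]
  rw [← mul_inv]
  congr 1
  field_simp
  ring

lemma tendsto_ofReal_sub_div_ofReal_sub {l : Filter ℝ} (hl : Tendsto (fun s : ℝ => ‖s‖) l atTop)
    (b : ℂ) {w : ℂ} (hw : w.im ≠ 0) :
    Tendsto (fun s : ℝ => ((s : ℂ) - b) / ((s : ℂ) - w)) l (𝓝 1) := by
  have h1 : Tendsto (fun s : ℝ => ‖(s : ℂ) - w‖) l atTop := by
    refine tendsto_atTop_mono (fun s => ?_) (tendsto_atTop_add_const_right l (-‖w‖) hl)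
    rw [← Complex.norm_real s]
    simpa [sub_eq_add_neg] using norm_sub_norm_le (s : ℂ) w
  have h2 : Tendsto (fun s : ℝ => ((s : ℂ) - w)⁻¹) l (𝓝 0) :=
    tendsto_inv₀_cobounded.comp (tendsto_norm_atTop_iff_cobounded.1 h1)
  have h3 := (h2.const_mul (w - b)).const_add 1
  rw [mul_zero, add_zero] at h3
  refine h3.congr fun s => ?_
  have := ofReal_sub_ne_zero hw s
  field_simp
  ring

/-- Both poles lie on the same side of the line. In place of a contour, an explicit primitive is
used that vanishes at both ends. -/
lemma integral_inv_mul_inv_eq_zero {b w : ℂ} (hb : b.im < 0) (hw : w.im < 0) :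
    ∫ s : ℝ, ((s : ℂ) - b)⁻¹ * ((s : ℂ) - w)⁻¹ = 0 := by
  have hint : Integrable fun s : ℝ => ((s : ℂ) - b)⁻¹ * ((s : ℂ) - w)⁻¹ :=
    MemLp.integrable_mul (p := 2) (q := 2) (memLp_inv_ofReal_sub hb.ne) (memLp_inv_ofReal_sub hw.ne)
  have hb0 := ofReal_sub_ne_zero hb.ne
  have hw0 := ofReal_sub_ne_zero hw.ne
  have hsub : ∀ (a : ℂ) (s : ℝ), HasDerivAt (fun s : ℝ => (s : ℂ) - a) 1 s := fun a s =>
    ((hasDerivAt_id (s : ℂ)).comp_ofReal).sub_const a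
  have htop : Tendsto (fun s : ℝ => ‖s‖) atTop atTop := tendsto_abs_atTop_atTop
  have hbot : Tendsto (fun s : ℝ => ‖s‖) atBot atTop := tendsto_abs_atBot_atTop
  by_cases hbw : b = w
  · subst hbw
    have hlim : ∀ l : Filter ℝ, Tendsto (fun s : ℝ => ‖s‖) l atTop →
        Tendsto (fun s : ℝ => -((s : ℂ) - b)⁻¹) l (𝓝 0) := fun l hl => by
      have h1 : Tendsto (fun s : ℝ => ‖(s : ℂ) - b‖) l atTop := by
        refine tendsto_atTop_mono (fun s => ?_) (tendsto_atTop_add_const_right l (-‖b‖) hl)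
        rw [← Complex.norm_real s]
        simpa [sub_eq_add_neg] using norm_sub_norm_le (s : ℂ) b
      rw [← neg_zero]
      exact (tendsto_inv₀_cobounded.comp (tendsto_norm_atTop_iff_cobounded.1 h1)).neg
    rw [integral_of_hasDerivAt_of_tendsto (f := fun s : ℝ => -((s : ℂ) - b)⁻¹) (fun s => ?_) hint
      (hlim _ hbot) (hlim _ htop), sub_zero]
    have h2 := ((hsub b s).inv (hb0 s)).neg
    exact h2.congr_deriv (by have := hb0 s; field_simp)
  · have hbw' : b - w ≠ 0 := sub_ne_zero.2 hbw
    -- Numerator and denominator both lie in the upper half-plane, so their quotient is never a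
    -- nonpositive real and the principal logarithm is smooth along the line.
    have hslit : ∀ s : ℝ, ((s : ℂ) - b) / ((s : ℂ) - w) ∈ Complex.slitPlane := by
      intro s
      by_contra hn
      rw [Complex.mem_slitPlane_iff_not_le_zero, not_not] at hn
      obtain ⟨t, ht, hts⟩ : ∃ t : ℝ, t ≤ 0 ∧ ((s : ℂ) - b) / ((s : ℂ) - w) = t := by
        refine ⟨(((s : ℂ) - b) / ((s : ℂ) - w)).re, (Complex.le_def.1 hn).1, ?_⟩
        refine Complex.ext rfl ?_
        simpa using (Complex.le_def.1 hn).2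
      rw [div_eq_iff (hw0 s)] at hts
      have := congrArg Complex.im hts
      simp at this
      nlinarith
    have hlim : ∀ l : Filter ℝ, Tendsto (fun s : ℝ => ‖s‖) l atTop →
        Tendsto (fun s : ℝ => (b - w)⁻¹ * Complex.log (((s : ℂ) - b) / ((s : ℂ) - w))) l (𝓝 0) := by
      intro l hl
      have h1 := (tendsto_ofReal_sub_div_ofReal_sub hl b hw.ne).clog (by simp)
      simpa using h1.const_mul (b - w)⁻¹
    rw [integral_of_hasDerivAt_of_tendsto
      (f := fun s : ℝ => (b - w)⁻¹ * Complex.log (((s : ℂ) - b) / ((s : ℂ) - w))) (fun s => ?_) hint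
      (hlim _ hbot) (hlim _ htop), sub_zero]
    have h2 := (((hsub b s).div (hsub w s) (hw0 s)).clog_real (hslit s)).const_mul (b - w)⁻¹
    refine h2.congr_deriv ?_
    have h3 := hb0 s
    have h4 := hw0 s
    simp only [Pi.div_apply]
    field_simp
    ring

lemma memLp_cauchyVector {a : ℂ} (ha : a.im ≠ 0) (j : Fin 2) :
    MemLp (fun s : ℝ => EuclideanSpace.single j ((s : ℂ) - a)⁻¹) 2 := by
  refine MemLp.of_eval_piLp fun i => ?_
  by_cases h : i = j
  · simpa [h] using memLp_inv_ofReal_sub ha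
  · simp [h]

/-- The row vector `s ↦ (s - a)⁻¹ eⱼ` in `L²(ℝ)`. -/
def cauchyVector (a : ℂ) (ha : a.im ≠ 0) (j : Fin 2) : RowL2 := (memLp_cauchyVector ha j).toLp _

/-- The inner product conjugates its first argument, so the vector with pole a represents the Cauchy
integral at the reflected point. -/
lemma inner_cauchyVector {a : ℂ} (ha : a.im ≠ 0) (j : Fin 2) (G : RowL2) :
    inner ℂ (cauchyVector a ha j) G = ∫ s : ℝ, G s j / ((s : ℂ) - star a) := by
  rw [L2.inner_def]
  refine integral_congr_ae ?_
  filter_upwards [(memLp_cauchyVector ha j).coeFn_toLp] with s hs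
  rw [cauchyVector, hs, EuclideanSpace.inner_single_left]
  simp [div_eq_inv_mul]

lemma integrable_div_ofReal_sub {a : ℂ} (ha : a.im ≠ 0) (j : Fin 2) (G : RowL2) :
    Integrable fun s : ℝ => G s j / ((s : ℂ) - a) := by
  simp_rw [div_eq_mul_inv]
  exact MemLp.integrable_mul (p := 2) (q := 2) ((Lp.memLp G).eval_piLp j) (memLp_inv_ofReal_sub ha)

/-- Conjugation reflects a into the lower half-plane, where w already lies. -/
lemma inner_cauchyVector_cauchyVector_eq_zero {a w : ℂ} (ha : 0 < a.im) (hw : w.im < 0)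
    (i j : Fin 2) : inner ℂ (cauchyVector a ha.ne' i) (cauchyVector w hw.ne j) = 0 := by
  rw [inner_cauchyVector]
  have h1 : ∫ s : ℝ, (cauchyVector w hw.ne j) s i / ((s : ℂ) - star a) =
      ∫ s : ℝ, (if i = j then 1 else 0) * (((s : ℂ) - w)⁻¹ * ((s : ℂ) - star a)⁻¹) := by
    refine integral_congr_ae ?_
    filter_upwards [(memLp_cauchyVector hw.ne j).coeFn_toLp] with s hs
    rw [cauchyVector, hs]
    by_cases h : i = j <;> simp [h, div_eq_mul_inv]
  rw [h1, integral_const_mul, integral_inv_mul_inv_eq_zero hw (by simpa using ha), mul_zero]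

/-- The Hardy space of the lower half-plane, on the real line: the closed span of the functions
`(s - a)⁻¹ eⱼ` with `a` in the upper half-plane. -/
def lowerHardySpace : Submodule ℂ RowL2 :=
  (Submodule.span ℂ {G | ∃ (a : ℂ) (ha : 0 < a.im) (j : Fin 2), G = cauchyVector a ha.ne' j}).topologicalClosure

instance : CompleteSpace lowerHardySpace :=
  (Submodule.isClosed_topologicalClosure _).completeSpace_coe

lemma lowerHardySpace_starProjection_cauchyVector {a : ℂ} (ha : 0 < a.im) (j : Fin 2) :
    lowerHardySpace.starProjection (cauchyVector a ha.ne' j) = cauchyVector a ha.ne' j :=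
  Submodule.starProjection_eq_self_iff.2
    (Submodule.le_topologicalClosure _ (Submodule.subset_span ⟨a, ha, j, rfl⟩))

lemma lowerHardySpace_starProjection_cauchyVector_eq_zero {w : ℂ} (hw : w.im < 0) (j : Fin 2) :
    lowerHardySpace.starProjection (cauchyVector w hw.ne j) = 0 := by
  rw [Submodule.starProjection_apply_eq_zero_iff, lowerHardySpace, Submodule.orthogonal_closure]
  refine (Submodule.mem_orthogonal _ _).2 fun u hu => ?_
  induction hu using Submodule.span_induction with
  | mem x hx =>
    obtain ⟨a, ha, i, rfl⟩ := hx
    exact inner_cauchyVector_cauchyVector_eq_zero ha hw i j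
  | zero => exact inner_zero_left _
  | add x y _ _ hx hy => rw [inner_add_left, hx, hy, add_zero]
  | smul c x _ hx => rw [inner_smul_left, hx, mul_zero]

/-- Below the line, the Cauchy integral of `G` is minus the Poisson integral of the projection of
`G` to the Hardy space of the lower half-plane. -/
lemma cauchyOperator_eq_neg_integral_poissonKernelLine (G : RowL2) (j : Fin 2) (z : ℝ) {ε : ℝ}
    (hε : 0 < ε) :
    cauchyOperator (fun s => G s j) ((z : ℂ) - (ε : ℂ) * Complex.I) =
      -∫ s, (poissonKernelLine ε (s - z) : ℂ) * (lowerHardySpace.starProjection G) s j := by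
  set F := lowerHardySpace.starProjection G
  set w : ℂ := (z : ℂ) - (ε : ℂ) * Complex.I with hw
  have hwim : w.im < 0 := by simpa [hw] using hε
  have hsim : 0 < (star w).im := by simpa using hwim
  -- The kernel with pole `star w` belongs to the Hardy space, so the Cauchy integral at w does not
  -- see the complement of the projection.
  have h1 : ∫ s : ℝ, F s j / ((s : ℂ) - w) = ∫ s : ℝ, G s j / ((s : ℂ) - w) := by
    have h := lowerHardySpace.inner_starProjection_left_eq_right (cauchyVector _ hsim.ne' j) G
    rw [lowerHardySpace_starProjection_cauchyVector hsim, inner_cauchyVector, inner_cauchyVector,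
      star_star] at h
    exact h.symm
  -- The kernel with pole w is orthogonal to the Hardy space. Subtracting this vanishing integral
  -- turns the Cauchy kernel into the Poisson kernel.
  have h2 : ∫ s : ℝ, F s j / ((s : ℂ) - star w) = 0 := by
    have h := lowerHardySpace.inner_starProjection_left_eq_right (cauchyVector _ hwim.ne j) G
    rw [lowerHardySpace_starProjection_cauchyVector_eq_zero hwim, inner_zero_left,
      inner_cauchyVector] at h
    exact h.symm
  rw [cauchyOperator, ← h1, ← sub_zero (∫ s : ℝ, F s j / ((s : ℂ) - w)), ← h2,
    ← integral_sub (integrable_div_ofReal_sub hwim.ne j F) (integrable_div_ofReal_sub hsim.ne' j F),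
    ← integral_const_mul, ← integral_neg]
  refine integral_congr_ae (ae_of_all _ fun s => ?_)
  have h3 := ofReal_sub_ne_zero hwim.ne s
  have h4 := ofReal_sub_ne_zero hsim.ne' s
  have hstar : star w = (z : ℂ) + (ε : ℂ) * Complex.I := by simp [hw]
  have h5 : ((s : ℂ) - w) * ((s : ℂ) - star w) = ((ε : ℂ) ^ 2 + (s - z) ^ 2) := by
    rw [hstar, hw]
    linear_combination (-(ε : ℂ) ^ 2) * Complex.I_sq
  have h6 : ((ε : ℂ) ^ 2 + (s - z) ^ 2) ≠ 0 := h5 ▸ mul_ne_zero h3 h4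
  have hε0 : (ε : ℂ) ≠ 0 := by exact_mod_cast hε.ne'
  have hpi : (Real.pi : ℂ) ≠ 0 := by exact_mod_cast Real.pi_ne_zero
  have h7 : F s j / ((s : ℂ) - w) - F s j / ((s : ℂ) - star w) =
      F s j * (-2 * ε * Complex.I) / ((ε : ℂ) ^ 2 + (s - z) ^ 2) := by
    rw [← h5, div_sub_div _ _ h3 h4]
    congr 1
    rw [hstar, hw]
    ring
  have h8 : (poissonKernelLine ε (s - z) : ℂ) = ε / Real.pi / ((ε : ℂ) ^ 2 + (s - z) ^ 2) := by
    have : 1 + (((s : ℂ) - z) / ε) ^ 2 = ((ε : ℂ) ^ 2 + (s - z) ^ 2) / ε ^ 2 := by field_simp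
    rw [poissonKernelLine]
    push_cast
    rw [this]
    field_simp
  simp only [h7, h8]
  field_simp

lemma hasPlemeljMinus_starProjection (G : RowL2) (j : Fin 2) :
    HasPlemeljMinus (fun s => G s j) (fun s => -(lowerHardySpace.starProjection G) s j) := by
  filter_upwards [ae_tendsto_integral_poissonKernelLine
    ((Lp.memLp (lowerHardySpace.starProjection G)).eval_piLp j)] with z hz
  refine hz.neg.congr' ?_
  filter_upwards [self_mem_nhdsWithin] with ε hε
  exact (cauchyOperator_eq_neg_integral_poissonKernelLine G j z hε).symm

/-! ### Inverting a compression with coercive symbol -/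

section Compression
variable {H : Type*} [NormedAddCommGroup H] [InnerProductSpace ℂ H] [CompleteSpace H]

/-- With respect to `U` and its complement, 1 - P + PV is block triangular. It factors as (1 + N)A,
where A = 1 - P + PVP is block diagonal and N = PV(1 - P) squares to zero. A inherits the coercivity
of V on `U` and is the identity on the complement, where c ≤ 1 enters. -/
lemma exists_equiv_of_coercive_symbol (U : Submodule ℂ H) [U.HasOrthogonalProjection]
    (V : H →L[ℂ] H) {c : ℝ} (hc : 0 < c) (hc1 : c ≤ 1)
    (hV : ∀ g, c * ‖g‖ ^ 2 ≤ (inner ℂ (V g) g).re) :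
    ∃ e : H ≃L[ℂ] H, (e : H →L[ℂ] H) = 1 - U.starProjection + U.starProjection * V ∧
      ∀ f, ‖e.symm f‖ ≤ c⁻¹ * (1 + ‖V‖) * ‖f‖ := by
  set P : H →L[ℂ] H := U.starProjection with hPdef
  have hPP : P * P = P := U.isIdempotentElem_starProjection
  have hsymm : ∀ u v, inner ℂ (P u) v = inner ℂ u (P v) := U.inner_starProjection_left_eq_right
  set A : H →L[ℂ] H := 1 - P + P * V * P with hA
  set N : H →L[ℂ] H := P * V * (1 - P) with hN
  have hNN : N * N = 0 := by
    have : (1 - P) * P = 0 := by rw [sub_mul, one_mul, hPP, sub_self]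
    calc N * N = P * V * ((1 - P) * P) * (V * (1 - P)) := by rw [hN]; noncomm_ring
      _ = 0 := by rw [this]; simp
  have hT : (1 + N) * A = 1 - P + P * V := by
    have h1 : (1 - P) * A = 1 - P := by
      have : (1 - P) * A = 1 - P - P + P * P + (P - P * P) * V * P := by rw [hA]; noncomm_ring
      rw [this, hPP]
      simp
    have : (1 + N) * A = A + P * V * ((1 - P) * A) := by rw [hN]; noncomm_ring
    rw [this, h1, hA]
    noncomm_ring
  have hcoer : ∀ g, c * ‖g‖ ^ 2 ≤ (inner ℂ (A g) g).re := by
    intro g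
    have hpy : ‖g‖ ^ 2 = ‖P g‖ ^ 2 + ‖g - P g‖ ^ 2 := by
      have h0 : inner ℂ (P g) (g - P g) = 0 := by
        rw [inner_sub_right, hsymm g (P g)]
        have : P (P g) = P g := congrArg (fun T : H →L[ℂ] H => T g) hPP
        rw [this, hsymm, sub_self]
      have := norm_add_sq_eq_norm_sq_add_norm_sq_of_inner_eq_zero _ _ h0
      rw [add_sub_cancel] at this
      simpa [sq] using this
    have hin : inner ℂ (A g) g = inner ℂ (g - P g) (g - P g) + inner ℂ (V (P g)) (P g) := by
      have hPg : P (P g) = P g := congrArg (fun T : H →L[ℂ] H => T g) hPP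
      have e1 : A g = (g - P g) + P (V (P g)) := by simp [hA]
      rw [e1, inner_add_left, hsymm (V (P g)) g]
      congr 1
      have : inner ℂ (P g) (P g) = inner ℂ g (P g) := by rw [hsymm g (P g), hPg]
      rw [inner_sub_right (g - P g) g (P g), inner_sub_left g (P g) (P g), this, sub_self, sub_zero]
    rw [hin, Complex.add_re, hpy]
    have h1 := hV (P g)
    have h2 : (inner ℂ (g - P g) (g - P g)).re = ‖g - P g‖ ^ 2 := by
      rw [inner_self_eq_norm_sq_to_K]
      norm_cast
    rw [h2]
    nlinarith [sq_nonneg ‖g - P g‖]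
  have hAu : IsUnit A := by
    refine ContinuousLinearMap.isUnit_of_forall_le_norm_inner_map A (c := ⟨c, hc.le⟩) hc fun x => ?_
    rw [mul_comm]
    exact (hcoer x).trans (Complex.re_le_norm _)
  have hNu : IsUnit (1 + N) :=
    ⟨⟨1 + N, 1 - N, by rw [add_mul, mul_sub, mul_sub, hNN]; simp,
      by rw [sub_mul, mul_add, mul_add, hNN]; simp⟩, rfl⟩
  obtain ⟨T, hTu⟩ := hNu.mul hAu
  rw [hT] at hTu
  refine ⟨ContinuousLinearEquiv.unitsEquiv ℂ H T, by rw [← hTu]; rfl, fun f => ?_⟩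
  set e := ContinuousLinearEquiv.unitsEquiv ℂ H T
  set g := e.symm f with hg
  have hgf : (1 - P + P * V) g = f := by
    rw [← hTu]
    exact e.apply_symm_apply f
  -- Applying 1 - N, the inverse of 1 + N, reduces the bound on g to the coercivity of A.
  have hAg : A g = f - N f := by
    have h1 : (1 - N) * (1 - P + P * V) = A := by
      rw [← hT, ← mul_assoc]
      have : (1 - N) * (1 + N) = 1 := by rw [sub_mul, mul_add, mul_add, hNN]; simp
      rw [this, one_mul]
    rw [← h1, mul_apply_eq_comp, hgf]
    simp
  have hNle : ‖N f‖ ≤ ‖V‖ * ‖f‖ := by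
    have hP : ∀ y, ‖P y‖ ≤ ‖y‖ := U.norm_starProjection_apply_le
    have hQ : ‖f - P f‖ ≤ ‖f‖ := by
      have := Uᗮ.norm_starProjection_apply_le f
      rwa [Submodule.starProjection_orthogonal'] at this
    calc ‖N f‖ ≤ ‖V (f - P f)‖ := by simpa [hN] using hP (V (f - P f))
      _ ≤ ‖V‖ * ‖f - P f‖ := V.le_opNorm _
      _ ≤ _ := by gcongr
  have hle : c * ‖g‖ ^ 2 ≤ (1 + ‖V‖) * ‖f‖ * ‖g‖ := by
    calc c * ‖g‖ ^ 2 ≤ ‖A g‖ * ‖g‖ :=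
          (hcoer g).trans ((Complex.re_le_norm _).trans (norm_inner_le_norm _ _))
      _ ≤ _ := by
        gcongr
        rw [hAg]
        linarith [norm_sub_le f (N f)]
  rcases (norm_nonneg g).eq_or_lt with h0 | h0
  · rw [← h0]
    positivity
  · rw [mul_assoc, ← div_eq_inv_mul, le_div_iff₀ hc]
    nlinarith
end Compression

/-! ### Jump matrices: boundedness and coercivity -/

/-- The common form of the scattering matrices on the two half-lines. -/
def jumpMatrix (δ : ℝ) (q : ℂ) : Matrix (Fin 2) (Fin 2) ℂ :=
  !![((δ * ‖q‖ ^ 2 : ℝ) : ℂ), δ * star q; q, 0]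

lemma vecMul_jumpMatrix_zero (g : Fin 2 → ℂ) (δ : ℝ) (q : ℂ) :
    (g ᵥ* jumpMatrix δ q) 0 = g 0 * ((δ * ‖q‖ ^ 2 : ℝ) : ℂ) + g 1 * q := by
  simp [jumpMatrix, Matrix.vecMul, dotProduct, Fin.sum_univ_two]

lemma vecMul_jumpMatrix_one (g : Fin 2 → ℂ) (δ : ℝ) (q : ℂ) :
    (g ᵥ* jumpMatrix δ q) 1 = g 0 * (δ * star q) := by
  simp [jumpMatrix, Matrix.vecMul, dotProduct, Fin.sum_univ_two]

lemma spectralRoot_sq (z : ℝ) : spectralRoot z ^ 2 = z := by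
  unfold spectralRoot
  split_ifs with h
  · rw [← Complex.ofReal_pow, Real.sq_sqrt h]
  · rw [mul_pow, Complex.I_sq, ← Complex.ofReal_pow, Real.sq_sqrt (by linarith)]
    push_cast
    ring

lemma spectralRoot_im_eq_zero_iff (z : ℝ) : (spectralRoot z).im = 0 ↔ 0 ≤ z := by
  unfold spectralRoot
  split_ifs with h
  · simp [h]
  · simp only [Complex.mul_im, Complex.I_re, Complex.I_im, Complex.ofReal_re, Complex.ofReal_im,
      h, iff_false]
    have := Real.sqrt_pos.2 (by linarith : 0 < -z)
    simp
    linarith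

/-- Since λ² = z is real, the exponentials are unimodular and can be absorbed into the reflection
coefficient without changing its modulus. -/
lemma scatteringMatrix_spectralRoot (r : ℂ → ℂ) (x z : ℝ) :
    scatteringMatrix r x (spectralRoot z) =
      jumpMatrix (if 0 ≤ z then 1 else -1)
        (r (spectralRoot z) * Complex.exp (2 * Complex.I * z * x)) := by
  have hn : ‖Complex.exp (2 * Complex.I * z * x)‖ = 1 := by
    rw [show 2 * Complex.I * z * x = ((2 * z * x : ℝ) : ℂ) * Complex.I by push_cast; ring]
    exact Complex.norm_exp_ofReal_mul_I _
  have hs : star (Complex.exp (2 * Complex.I * z * x)) = Complex.exp (-2 * Complex.I * z * x) := by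
    rw [Complex.star_def, ← Complex.exp_conj]
    simp [Complex.conj_ofNat]
  have hst : star (r (spectralRoot z) * Complex.exp (2 * Complex.I * z * x)) =
      star (r (spectralRoot z)) * Complex.exp (-2 * Complex.I * z * x) := by
    rw [star_mul', hs]
  rw [scatteringMatrix, jumpMatrix, hst, norm_mul, hn, mul_one, spectralRoot_sq]
  simp only [spectralRoot_im_eq_zero_iff]
  split_ifs <;> simp

lemma norm_vecMul_jumpMatrix_le {δ : ℝ} (hδ : |δ| = 1) {q : ℂ} {M : ℝ} (hq : ‖q‖ ≤ M)
    (g : EuclideanSpace ℂ (Fin 2)) :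
    ‖WithLp.toLp 2 (g.ofLp ᵥ* jumpMatrix δ q)‖ ≤ (M ^ 2 + 2 * M) * ‖g‖ := by
  have hM : 0 ≤ M := (norm_nonneg q).trans hq
  have h0 := PiLp.norm_apply_le g 0
  have h1 := PiLp.norm_apply_le g 1
  have e0 : ‖(g.ofLp ᵥ* jumpMatrix δ q) 0‖ ≤ (M ^ 2 + M) * ‖g‖ := by
    rw [vecMul_jumpMatrix_zero]
    calc _ ≤ ‖g 0‖ * ‖q‖ ^ 2 + ‖g 1‖ * ‖q‖ := by
          refine (norm_add_le _ _).trans_eq ?_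
          rw [norm_mul, norm_mul, Complex.norm_real, norm_mul, Real.norm_eq_abs, hδ, one_mul,
            Real.norm_of_nonneg (by positivity)]
      _ ≤ ‖g‖ * M ^ 2 + ‖g‖ * M := by gcongr
      _ = _ := by ring
  have e1 : ‖(g.ofLp ᵥ* jumpMatrix δ q) 1‖ ≤ M * ‖g‖ := by
    rw [vecMul_jumpMatrix_one, norm_mul, norm_mul, Complex.norm_real, Real.norm_eq_abs, hδ, one_mul,
      norm_star, mul_comm]
    gcongr
  have : WithLp.toLp 2 (g.ofLp ᵥ* jumpMatrix δ q) =
      EuclideanSpace.single 0 ((g.ofLp ᵥ* jumpMatrix δ q) 0) +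
      EuclideanSpace.single 1 ((g.ofLp ᵥ* jumpMatrix δ q) 1) := by
    ext i
    fin_cases i <;> simp
  rw [this]
  refine (norm_add_le _ _).trans ?_
  rw [PiLp.norm_single, PiLp.norm_single]
  linarith

/-- Completing the square, the form equals |g₀|² + |g₁ + g₀ q̄|². -/
lemma le_re_inner_add_vecMul_jumpMatrix_one {q : ℂ} {M : ℝ} (hq : ‖q‖ ≤ M)
    (g : EuclideanSpace ℂ (Fin 2)) :
    (2 + 2 * M ^ 2)⁻¹ * ‖g‖ ^ 2 ≤
      (inner ℂ (g + WithLp.toLp 2 (g.ofLp ᵥ* jumpMatrix 1 q)) g).re := by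
  have hq2 : ‖q‖ ^ 2 ≤ M ^ 2 := by gcongr
  rw [PiLp.inner_apply, EuclideanSpace.norm_sq_eq, Fin.sum_univ_two, Fin.sum_univ_two]
  simp only [PiLp.add_apply, vecMul_jumpMatrix_zero, vecMul_jumpMatrix_one]
  rw [← Complex.normSq_eq_norm_sq, Complex.normSq_apply] at hq2
  rw [← Complex.normSq_eq_norm_sq, Complex.normSq_apply,
    ← Complex.normSq_eq_norm_sq, Complex.normSq_apply, inv_mul_le_iff₀ (by positivity)]
  simp [← Complex.normSq_eq_norm_sq, Complex.normSq_apply]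
  set a := (g.ofLp 0).re
  set b := (g.ofLp 0).im
  set c := (g.ofLp 1).re
  set d := (g.ofLp 1).im
  set u := q.re
  set v := q.im
  -- This is |g₁|² ≤ 2|g₁ + g₀ q̄|² + 2|g₀|²|q|², the source of the constant 2 + 2M².
  have h1 : c * c + d * d ≤ 2 * ((c + (a * u + b * v)) ^ 2 + (d + (b * u - a * v)) ^ 2) +
      2 * ((a * a + b * b) * (u * u + v * v)) := by
    linarith [sq_nonneg (c + 2 * (a * u + b * v)), sq_nonneg (d + 2 * (b * u - a * v))]
  have h2 : (a * a + b * b) * (u * u + v * v) ≤ (a * a + b * b) * M ^ 2 :=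
    mul_le_mul_of_nonneg_left hq2 (add_nonneg (mul_self_nonneg _) (mul_self_nonneg _))
  have h3 : 0 ≤ M ^ 2 * ((c + (a * u + b * v)) ^ 2 + (d + (b * u - a * v)) ^ 2) := by positivity
  have h4 : 0 ≤ a * a + b * b := add_nonneg (mul_self_nonneg _) (mul_self_nonneg _)
  linarith

/-- The off-diagonal part is skew-Hermitian and drops out of the real part, which is (1 - |q|²)|g₀|²
+ |g₁|². -/
lemma le_re_inner_add_vecMul_jumpMatrix_neg_one {q : ℂ} {c : ℝ} (hc : c ≤ 1)
    (hq : c ≤ 1 - ‖q‖ ^ 2) (g : EuclideanSpace ℂ (Fin 2)) :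
    c * ‖g‖ ^ 2 ≤ (inner ℂ (g + WithLp.toLp 2 (g.ofLp ᵥ* jumpMatrix (-1) q)) g).re := by
  rw [PiLp.inner_apply, EuclideanSpace.norm_sq_eq, Fin.sum_univ_two, Fin.sum_univ_two]
  simp only [PiLp.add_apply, vecMul_jumpMatrix_zero, vecMul_jumpMatrix_one]
  rw [← Complex.normSq_eq_norm_sq, Complex.normSq_apply] at hq
  rw [← Complex.normSq_eq_norm_sq, Complex.normSq_apply,
    ← Complex.normSq_eq_norm_sq, Complex.normSq_apply]
  simp [← Complex.normSq_eq_norm_sq, Complex.normSq_apply]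
  have h1 := mul_le_mul_of_nonneg_right hq
    (add_nonneg (mul_self_nonneg _) (mul_self_nonneg _) :
      0 ≤ (g.ofLp 0).re * (g.ofLp 0).re + (g.ofLp 0).im * (g.ofLp 0).im)
  have h2 := mul_le_mul_of_nonneg_right hc
    (add_nonneg (mul_self_nonneg _) (mul_self_nonneg _) :
      0 ≤ (g.ofLp 1).re * (g.ofLp 1).re + (g.ofLp 1).im * (g.ofLp 1).im)
  linarith

lemma aestronglyMeasurable_vecMul_jumpMatrix {δ : ℝ → ℝ} {q : ℝ → ℂ} (hδ : Measurable δ)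
    (hq : AEStronglyMeasurable q) (G : RowL2) :
    AEStronglyMeasurable (fun z => WithLp.toLp 2 ((G z).ofLp ᵥ* jumpMatrix (δ z) (q z))) := by
  have hG : ∀ j, AEMeasurable fun z => G z j := fun j =>
    ((Lp.memLp G).eval_piLp j).1.aemeasurable
  have hq := hq.aemeasurable
  have hδ := hδ.aemeasurable (μ := volume)
  have hc : ∀ j, AEMeasurable fun z => ((G z).ofLp ᵥ* jumpMatrix (δ z) (q z)) j := by
    intro j
    have h0 := hG 0
    have h1 := hG 1
    fin_cases j
    · simp only [Fin.zero_eta, vecMul_jumpMatrix_zero]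
      fun_prop
    · simp only [Fin.mk_one, vecMul_jumpMatrix_one]
      have : AEMeasurable fun z => star (q z) := Complex.continuous_conj.measurable.comp_aemeasurable hq
      fun_prop
  exact ((PiLp.continuous_toLp 2 _).measurable.comp_aemeasurable
    (aemeasurable_pi_lambda _ hc)).aestronglyMeasurable

/-- Right multiplication of row vectors in `L²(ℝ)` by bounded jump matrices. -/
lemma exists_mul_jumpMatrix {δ : ℝ → ℝ} {q : ℝ → ℂ} (hδ : Measurable δ) (hδ1 : ∀ z, |δ z| = 1)
    (hq : AEStronglyMeasurable q) {M : ℝ} (hM : 0 ≤ M) (hqM : ∀ᵐ z : ℝ, ‖q z‖ ≤ M) :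
    ∃ T : RowL2 →L[ℂ] RowL2, ‖T‖ ≤ M ^ 2 + 2 * M ∧
      ∀ G : RowL2, ∀ᵐ z : ℝ, T G z = WithLp.toLp 2 ((G z).ofLp ᵥ* jumpMatrix (δ z) (q z)) := by
  have hle : ∀ G : RowL2, ∀ᵐ z : ℝ,
      ‖WithLp.toLp 2 ((G z).ofLp ᵥ* jumpMatrix (δ z) (q z))‖ ≤ (M ^ 2 + 2 * M) * ‖G z‖ := fun G => by
    filter_upwards [hqM] with z hz using norm_vecMul_jumpMatrix_le (hδ1 z) hz (G z)
  have hmem : ∀ G : RowL2, MemLp (fun z => WithLp.toLp 2 ((G z).ofLp ᵥ* jumpMatrix (δ z) (q z))) 2 :=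
    fun G => (Lp.memLp G).of_le_mul (aestronglyMeasurable_vecMul_jumpMatrix hδ hq G) (hle G)
  refine ⟨LinearMap.mkContinuous
    { toFun := fun G => (hmem G).toLp _
      map_add' := fun F G => ?_
      map_smul' := fun a G => ?_ } (M ^ 2 + 2 * M) fun G => ?_,
    LinearMap.mkContinuous_norm_le _ (by positivity) _, fun G => (hmem G).coeFn_toLp⟩
  · refine Lp.ext ?_
    filter_upwards [(hmem (F + G)).coeFn_toLp, (hmem F).coeFn_toLp, (hmem G).coeFn_toLp,
      Lp.coeFn_add F G, Lp.coeFn_add ((hmem F).toLp _) ((hmem G).toLp _)] with z h1 h2 h3 h4 h5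
    rw [h1, h5, Pi.add_apply, h2, h3, h4, Pi.add_apply, WithLp.ofLp_add, Matrix.add_vecMul,
      WithLp.toLp_add]
  · refine Lp.ext ?_
    filter_upwards [(hmem (a • G)).coeFn_toLp, (hmem G).coeFn_toLp,
      Lp.coeFn_smul a G, Lp.coeFn_smul a ((hmem G).toLp _)] with z h1 h2 h3 h4
    rw [h1, RingHom.id_apply, h4, Pi.smul_apply, h2, h3, Pi.smul_apply, WithLp.ofLp_smul,
      Matrix.smul_vecMul, WithLp.toLp_smul]
  · refine Lp.norm_le_mul_norm_of_ae_le_mul ?_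
    filter_upwards [hle G, (hmem G).coeFn_toLp] with z h1 h2
    exact (congrArg norm h2).trans_le h1

/-! ### From pointwise bounds to the operator, and the main theorem -/

lemma le_re_inner_of_ae {V : RowL2 →L[ℂ] RowL2} {c : ℝ} (G : RowL2)
    (h : ∀ᵐ z : ℝ, c * ‖G z‖ ^ 2 ≤ (inner ℂ (V G z) (G z)).re) :
    c * ‖G‖ ^ 2 ≤ (inner ℂ (V G) G).re := by
  have h1 : ‖G‖ ^ 2 = ∫ z, ‖G z‖ ^ 2 := by
    have h2 : ((‖G‖ ^ 2 : ℝ) : ℂ) = ∫ z, ((‖G z‖ ^ 2 : ℝ) : ℂ) := by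
      have := inner_self_eq_norm_sq_to_K (𝕜 := ℂ) G
      rw [L2.inner_def] at this
      simp_rw [inner_self_eq_norm_sq_to_K] at this
      simpa using this.symm
    rw [integral_complex_ofReal] at h2
    exact_mod_cast h2
  have hi := L2.integrable_inner (𝕜 := ℂ) (V G) G
  rw [h1, ← integral_const_mul, L2.inner_def]
  have hre : (∫ z, inner ℂ (V G z) (G z)).re = ∫ z, (inner ℂ (V G z) (G z)).re :=
    (integral_re hi).symm
  rw [hre]
  refine integral_mono_ae ?_ hi.re h
  exact ((memLp_two_iff_integrable_sq_norm (Lp.memLp G).1).1 (Lp.memLp G)).const_mul c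

/-- Elements of L² are classes, and products and projections are known only almost everywhere. -/
lemma HasPlemeljMinus.congr {h h' p p' : ℝ → ℂ} (H : HasPlemeljMinus h p) (hh : h =ᵐ[volume] h')
    (hp : p =ᵐ[volume] p') : HasPlemeljMinus h' p' := by
  have : cauchyOperator h' = cauchyOperator h := by
    funext w
    unfold cauchyOperator
    congr 1
    refine integral_congr_ae ?_
    filter_upwards [hh] with s hs
    rw [hs]
  unfold HasPlemeljMinus
  rw [this]
  filter_upwards [H, hp] with z hz hpz
  rwa [← hpz]

end

theorem lemma4p7 (M : ℝ≥0) (c₀ : ℝ) (hc₀ : 0 < c₀) :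
    ∃ C : ℝ, 0 < C ∧
      ∀ r : ℂ → ℂ,
        MemLp (fun z : ℝ => r (spectralRoot z)) 2 volume →
        eLpNorm (fun z : ℝ => r (spectralRoot z)) ∞ volume ≤ (M : ℝ≥0∞) →
        (∀ᵐ z : ℝ, z < 0 → c₀ ^ 2 ≤ 1 - ‖r (spectralRoot z)‖ ^ 2) →
        ∀ x : ℝ,
          ∃ Q : RowL2 →L[ℂ] RowL2, IsPlemeljScattering r x Q ∧
            ∃ e : RowL2 ≃L[ℂ] RowL2,
              (e : RowL2 →L[ℂ] RowL2) = ContinuousLinearMap.id ℂ RowL2 - Q ∧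
              ∀ f : RowL2, ‖e.symm f‖ ≤ C * ‖f‖ := by
  -- The smaller of the coercivity constants on the two half-lines; the second also forces c ≤ 1.
  set c : ℝ := min (c₀ ^ 2) (2 + 2 * (M : ℝ) ^ 2)⁻¹ with hcdef
  have hc : 0 < c := lt_min (by positivity) (by positivity)
  have hc1 : c ≤ 1 := (min_le_right _ _).trans
    (inv_le_one_of_one_le₀ (by nlinarith [sq_nonneg (M : ℝ)]))
  -- From c⁻¹(1 + ‖V‖) with V = 1 + T and ‖T‖ ≤ M² + 2M.
  refine ⟨c⁻¹ * (2 + ((M : ℝ) ^ 2 + 2 * M)), by positivity, fun r hr hrM hrc x => ?_⟩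
  set δ : ℝ → ℝ := fun z => if 0 ≤ z then 1 else -1 with hδdef
  set q : ℝ → ℂ := fun z => r (spectralRoot z) * Complex.exp (2 * Complex.I * z * x) with hqdef
  have hqn : ∀ z, ‖q z‖ = ‖r (spectralRoot z)‖ := fun z => by
    rw [hqdef, norm_mul,
      show 2 * Complex.I * z * x = ((2 * z * x : ℝ) : ℂ) * Complex.I by push_cast; ring,
      Complex.norm_exp_ofReal_mul_I, mul_one]
  have hδ : Measurable δ := Measurable.ite measurableSet_Ici measurable_const measurable_const
  have hδ1 : ∀ z, |δ z| = 1 := fun z => by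
    simp only [hδdef]
    split_ifs <;> simp
  have hq : AEStronglyMeasurable q :=
    hr.1.mul (Continuous.aestronglyMeasurable (by fun_prop))
  have hqM : ∀ᵐ z : ℝ, ‖q z‖ ≤ M := by
    rw [eLpNorm_exponent_top] at hrM
    filter_upwards [ae_le_eLpNormEssSup (f := fun z : ℝ => r (spectralRoot z)) (μ := volume)] with z hz
    rw [hqn]
    have := hz.trans hrM
    rw [enorm_le_coe] at this
    exact_mod_cast this
  obtain ⟨T, hTn, hT⟩ := exists_mul_jumpMatrix hδ hδ1 hq M.coe_nonneg hqM
  obtain ⟨e, he, hle⟩ := exists_equiv_of_coercive_symbol lowerHardySpace (1 + T) hc hc1 fun G => by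
    refine le_re_inner_of_ae G ?_
    filter_upwards [hT G, hqM, hrc, Lp.coeFn_add G (T G)] with z h1 h2 h3 h4
    have h5 : ((1 + T) G) z = G z + WithLp.toLp 2 ((G z).ofLp ᵥ* jumpMatrix (δ z) (q z)) := by
      rw [← h1]
      exact h4
    rw [h5]
    rcases le_or_gt 0 z with hz | hz
    · have : δ z = 1 := if_pos hz
      rw [this]
      refine le_trans ?_ (le_re_inner_add_vecMul_jumpMatrix_one h2 (G z))
      gcongr
      exact min_le_right _ _
    · have : δ z = -1 := if_neg (not_le.2 hz)
      rw [this]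
      refine le_re_inner_add_vecMul_jumpMatrix_neg_one hc1 ?_ (G z)
      rw [hqn]
      exact (min_le_left _ _).trans (h3 hz)
  -- P⁻ = -Π makes P⁻_S = -ΠT, whence I - P⁻_S = 1 - Π + Π(1 + T), the operator inverted by `e`.
  refine ⟨-(lowerHardySpace.starProjection * T), fun G j => ?_, e, ?_, fun f => (hle f).trans ?_⟩
  · refine (hasPlemeljMinus_starProjection (T G) j).congr ?_ ?_
    · filter_upwards [hT G] with z hz
      rw [scatteringMatrix_spectralRoot, hz]
    · filter_upwards [Lp.coeFn_neg (lowerHardySpace.starProjection (T G))] with z hz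
      have : ((-(lowerHardySpace.starProjection * T)) G) z =
        -(lowerHardySpace.starProjection (T G)) z := hz
      rw [this]
      rfl
  · rw [he, mul_add, mul_one, sub_neg_eq_add, ← add_assoc, sub_add_cancel]
    rfl
  · refine mul_le_mul_of_nonneg_right (mul_le_mul_of_nonneg_left ?_ (by positivity)) (norm_nonneg f)
    calc 1 + ‖1 + T‖ ≤ 1 + (1 + ‖T‖) := by
          gcongr
          exact (norm_add_le _ _).trans (by gcongr; exact ContinuousLinearMap.norm_id_le)
      _ ≤ _ := by linarith
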